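/- For a finite non-negative Borel measure $\nu$ on $\mathbb R$ write $\widehat\nu(t)=\int_{\mathbb R}e^{itx}\,\nu(dx)$, and read $\frac{\sin u}{u}$ as $1$ at $u=0$. There exists a sequence of positive integers $(n_k)_{k\ge1}$ growing at least geometrically, that is, $n_k\ge\rho^k$ for all $k\ge1$ with some constant $\rho>1$, with the following property. For every $\varepsilon>0$ there is a constant $C_\varepsilon>0$, depending only on $\varepsilon$, such that for every $k\ge1$, every finite non-negative Borel measure $\nu$ on $\mathbb R$ whose transform $\widehat\nu$ is everywhere real and non-negative, and every $T>0$, $$\int_{-2^{n_k}T}^{2^{n_k}T}\widehat\nu(x)\,dx\;\le\;C_\varepsilon\,T\,2^{2^{(1+\varepsilon)n_k}}\int_{\mathbb R}\left|\frac{\sin(xT)}{xT}\right|^{n_k^2}\nu(dx).$$ -/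

import Mathlib

open MeasureTheory

/-! Averaging over `[a - T, a + T]` multiplies the measure by `sinc (x * T)`. As the transform is
nonnegative, its integral over one window is at most `2 ^ j` times what `j` further averagings give,
hence at most `T * 2 ^ p * ∫ |sinc| ^ p` for even `p ≥ 1`. With `p = n ^ 2` and `2 ^ n` windows
tiling the range, the loss is `2 ^ (n + n ^ 2)`, far below the allowed double exponential. -/

/-- The cosine transform of the signed measure `sinc (x * T) ^ j • ν`. -/
noncomputable def sincPowCosTransform (ν : Measure ℝ) (T : ℝ) (j : ℕ) (t : ℝ) : ℝ :=
  ∫ x, Real.sinc (x * T) ^ j * Real.cos (t * x) ∂ν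

theorem abs_sinc_pow_mul_cos_le_one (j : ℕ) (y z : ℝ) :
    |Real.sinc y ^ j * Real.cos z| ≤ 1 := by
  rw [abs_mul, abs_pow]
  exact mul_le_one₀ (pow_le_one₀ (abs_nonneg _) (Real.abs_sinc_le_one _)) (abs_nonneg _)
    (Real.abs_cos_le_one _)

theorem re_charFun_eq_sincPowCosTransform (ν : Measure ℝ) [IsFiniteMeasure ν] (T t : ℝ) :
    (charFun ν t).re = sincPowCosTransform ν T 0 t := by
  have hint : Integrable (fun x : ℝ => Complex.exp (t * x * Complex.I)) ν := by
    refine Integrable.of_bound (C := 1) (by fun_prop) (ae_of_all _ fun x => ?_)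
    rw [← Complex.ofReal_mul, Complex.norm_exp_ofReal_mul_I]
  rw [charFun_apply_real, sincPowCosTransform]
  refine (integral_re hint).symm.trans ?_
  congr 1
  ext x
  rw [← Complex.ofReal_mul]
  simpa using Complex.exp_ofReal_mul_I_re (t * x)

theorem continuous_sincPowCosTransform (ν : Measure ℝ) [IsFiniteMeasure ν] (T : ℝ) (j : ℕ) :
    Continuous (sincPowCosTransform ν T j) := by
  have hs := Real.continuous_sinc
  refine continuous_of_dominated (bound := fun _ => 1) (fun t => ?_) (fun t => ?_)
    (integrable_const _) (ae_of_all _ fun x => ?_)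
  · exact Continuous.aestronglyMeasurable (by fun_prop)
  · exact ae_of_all _ fun x => abs_sinc_pow_mul_cos_le_one _ _ _
  · fun_prop

theorem integral_cos_mul_window (T a x : ℝ) :
    ∫ u in (a - T)..(a + T), Real.cos (u * x) = 2 * T * (Real.sinc (x * T) * Real.cos (a * x)) := by
  rcases eq_or_ne x 0 with rfl | hx
  · simp; ring
  rcases eq_or_ne T 0 with rfl | hT
  · simp
  rw [intervalIntegral.integral_comp_mul_right (fun u => Real.cos u) hx, integral_cos,
    Real.sinc_of_ne_zero (mul_ne_zero hx hT), add_mul, sub_mul, Real.sin_add, Real.sin_sub,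
    mul_comm T x, smul_eq_mul]
  field_simp
  ring

theorem integral_sincPowCosTransform_window (ν : Measure ℝ) [IsFiniteMeasure ν] (T : ℝ) (j : ℕ)
    (a : ℝ) :
    ∫ u in (a - T)..(a + T), sincPowCosTransform ν T j u =
      2 * T * sincPowCosTransform ν T (j + 1) a := by
  have hs := Real.continuous_sinc
  have : IsFiniteMeasure (volume.restrict (Set.uIoc (a - T) (a + T))) :=
    ⟨by simp [Set.uIoc]⟩
  have hint : Integrable
      (Function.uncurry fun u x : ℝ => Real.sinc (x * T) ^ j * Real.cos (u * x))
      ((volume.restrict (Set.uIoc (a - T) (a + T))).prod ν) := by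
    refine Integrable.of_bound (C := 1) ?_ (ae_of_all _ fun z => ?_)
    · exact Continuous.aestronglyMeasurable (by unfold Function.uncurry; fun_prop)
    · exact abs_sinc_pow_mul_cos_le_one _ _ _
  unfold sincPowCosTransform
  rw [intervalIntegral_integral_swap hint, ← integral_const_mul]
  congr 1
  ext x
  rw [intervalIntegral.integral_const_mul, integral_cos_mul_window]
  ring

/-- Convolving a nonnegative function with the uniform law on `[-T, T]` repeatedly loses at most a
factor two at each step. -/
theorem window_le_sincPowCosTransform (ν : Measure ℝ) [IsFiniteMeasure ν] {T : ℝ} (hT : 0 < T)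
    (h0 : ∀ t, 0 ≤ sincPowCosTransform ν T 0 t) (j : ℕ) (a : ℝ) :
    ∫ u in (a - T)..(a + T), sincPowCosTransform ν T 0 u ≤
      2 * T * (2 ^ j * sincPowCosTransform ν T (j + 1) a) := by
  induction j generalizing a with
  | zero => simp [integral_sincPowCosTransform_window]
  | succ j ih =>
    have hI : ∀ i b c, IntervalIntegrable (sincPowCosTransform ν T i) volume b c := fun i b c =>
      (continuous_sincPowCosTransform ν T i).intervalIntegrable b c
    -- For every `u` in a half-window `[b, c]` of length `T`, the window `[u - T, u + T]` contains
    -- all of `[b, c]`; integrate the induction hypothesis over such `u`.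
    have half : ∀ b c, c - b = T →
        T * ∫ u in b..c, sincPowCosTransform ν T 0 u ≤
          2 * T * 2 ^ j * ∫ u in b..c, sincPowCosTransform ν T (j + 1) u := by
      intro b c hbc
      have hle : b ≤ c := by linarith
      have hconst := intervalIntegral.integral_const (a := b) (b := c)
        (∫ u in b..c, sincPowCosTransform ν T 0 u)
      rw [hbc, smul_eq_mul] at hconst
      rw [← hconst, ← intervalIntegral.integral_const_mul]
      refine intervalIntegral.integral_mono_on hle (by simp) ((hI _ _ _).const_mul _)
        fun u hu => ?_
      refine (intervalIntegral.integral_mono_interval (c := u - T) (d := u + T) ?_ hle ?_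
        (ae_of_all _ h0) (hI _ _ _)).trans ((ih u).trans_eq (by ring))
      · linarith [hu.2]
      · linarith [hu.1]
    have h1 := half (a - T) a (by ring)
    have h2 := half a (a + T) (by ring)
    have e0 := intervalIntegral.integral_add_adjacent_intervals
      (hI 0 (a - T) a) (hI 0 a (a + T))
    have e1 := intervalIntegral.integral_add_adjacent_intervals
      (hI (j + 1) (a - T) a) (hI (j + 1) a (a + T))
    rw [integral_sincPowCosTransform_window] at e1
    rw [← e0]
    refine le_of_mul_le_mul_left ?_ hT
    calc _ ≤ 2 * T * 2 ^ j * (2 * T * sincPowCosTransform ν T (j + 1 + 1) a) := by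
          rw [← e1]; linarith
      _ = _ := by ring

theorem sincPowCosTransform_le (ν : Measure ℝ) [IsFiniteMeasure ν] (T : ℝ) {p : ℕ} (hp : Even p)
    (a : ℝ) : sincPowCosTransform ν T p a ≤ ∫ x, |Real.sinc (x * T)| ^ p ∂ν := by
  have hs := Real.continuous_sinc
  refine integral_mono ?_ ?_ fun x => ?_
  · exact Integrable.of_bound (C := 1) (Continuous.aestronglyMeasurable (by fun_prop))
      (ae_of_all _ fun x => abs_sinc_pow_mul_cos_le_one _ _ _)
  · refine Integrable.of_bound (C := 1) (Continuous.aestronglyMeasurable (by fun_prop))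
      (ae_of_all _ fun x => ?_)
    rw [Real.norm_eq_abs, abs_pow, abs_abs]
    exact pow_le_one₀ (abs_nonneg _) (Real.abs_sinc_le_one _)
  · simp only [hp.pow_abs]
    exact mul_le_of_le_one_right (hp.pow_nonneg _) (Real.cos_le_one _)

theorem integral_re_charFun_le (ν : Measure ℝ) [IsFiniteMeasure ν]
    (h0 : ∀ t, 0 ≤ (charFun ν t).re) {T : ℝ} (hT : 0 < T) {p : ℕ} (hp : Even p) (hp0 : p ≠ 0)
    (N : ℕ) :
    ∫ x in (-(N * T))..(N * T), (charFun ν x).re ≤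
      N * (T * 2 ^ p * ∫ x, |Real.sinc (x * T)| ^ p ∂ν) := by
  obtain ⟨j, rfl⟩ := Nat.exists_eq_succ_of_ne_zero hp0
  simp only [re_charFun_eq_sincPowCosTransform ν T] at h0 ⊢
  -- Tile `[-N T, N T]` by `N` windows of length `2 T`.
  have hsum := intervalIntegral.sum_integral_adjacent_intervals (μ := volume)
    (f := sincPowCosTransform ν T 0) (a := fun i : ℕ => (2 * i - N) * T) (n := N)
    fun i _ => (continuous_sincPowCosTransform ν T 0).intervalIntegrable _ _
  have e1 : (2 * ((0 : ℕ) : ℝ) - N) * T = -(N * T) := by push_cast; ring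
  have e2 : (2 * (N : ℝ) - N) * T = N * T := by ring
  rw [e1, e2] at hsum
  rw [← hsum]
  refine (Finset.sum_le_card_nsmul _ _ (T * 2 ^ (j + 1) *
    ∫ x, |Real.sinc (x * T)| ^ (j + 1) ∂ν) fun i _ => ?_).trans_eq (by simp)
  have e3 : (2 * (i : ℝ) - N) * T = (2 * i + 1 - N) * T - T := by ring
  have e4 : (2 * ((i + 1 : ℕ) : ℝ) - N) * T = (2 * i + 1 - N) * T + T := by push_cast; ring
  rw [e3, e4]
  calc _ ≤ 2 * T * (2 ^ j * sincPowCosTransform ν T (j + 1) ((2 * i + 1 - N) * T)) :=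
        window_le_sincPowCosTransform ν hT h0 j _
    _ ≤ 2 * T * (2 ^ j * ∫ x, |Real.sinc (x * T)| ^ (j + 1) ∂ν) := by
        gcongr
        exact sincPowCosTransform_le ν T hp _
    _ = _ := by ring

/-- The gap 4 is attained at `m = 3` and `m = 4`; it yields the constant `16 = 2 ^ 4`. -/
theorem add_sq_le_four_add_two_pow (m : ℕ) : m + m ^ 2 ≤ 4 + 2 ^ m := by
  rcases lt_or_ge m 5 with h | h
  · interval_cases m <;> norm_num
  have : m + m ^ 2 ≤ 2 ^ m := by
    induction m, h using Nat.le_induction with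
    | base => norm_num
    | succ m hm ih => rw [pow_succ 2 m]; nlinarith
  omega

theorem two_pow_mul_two_pow_sq_le {ε : ℝ} (hε : 0 < ε) (m : ℕ) :
    (2 : ℝ) ^ m * 2 ^ (m ^ 2) ≤ 16 * (2 : ℝ) ^ ((2 : ℝ) ^ ((1 + ε) * (m : ℝ))) := by
  calc (2 : ℝ) ^ m * 2 ^ (m ^ 2) = 2 ^ (m + m ^ 2) := (pow_add _ _ _).symm
    _ ≤ 2 ^ (4 + 2 ^ m) := pow_le_pow_right₀ one_le_two (add_sq_le_four_add_two_pow m)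
    _ = 16 * (2 : ℝ) ^ ((2 : ℝ) ^ (m : ℝ)) := by
        rw [pow_add, Real.rpow_natCast]
        norm_num
        exact_mod_cast (Real.rpow_natCast 2 (2 ^ m)).symm
    _ ≤ _ := by
        have hm : (m : ℝ) ≤ (1 + ε) * m := by nlinarith [m.cast_nonneg (α := ℝ)]
        gcongr <;> norm_num

theorem theorem1 :
    ∃ n : ℕ → ℕ,
      (∃ ρ : ℝ, 1 < ρ ∧ ∀ k : ℕ, 1 ≤ k → ρ ^ k ≤ (n k : ℝ)) ∧
      ∀ ε : ℝ, 0 < ε →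
        ∃ C : ℝ, 0 < C ∧
          ∀ k : ℕ, 1 ≤ k →
          ∀ ν : Measure ℝ, IsFiniteMeasure ν →
            (∀ t : ℝ, (charFun ν t).im = 0 ∧ 0 ≤ (charFun ν t).re) →
            ∀ T : ℝ, 0 < T →
              (∫ x in (-((2 : ℝ) ^ (n k) * T))..((2 : ℝ) ^ (n k) * T), (charFun ν x).re) ≤
                C * (T * (2 : ℝ) ^ ((2 : ℝ) ^ ((1 + ε) * (n k : ℝ))) *
                  ∫ x, |Real.sinc (x * T)| ^ (n k ^ 2) ∂ν) := by

  -- Powers of two make the exponent `n k ^ 2` even, so `sinc ^ p = |sinc| ^ p`; `C = 16` serves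
  -- every `ε`.
  refine ⟨fun k => 2 ^ k, ⟨2, one_lt_two, fun k _ => by simp⟩, fun ε hε => ⟨16, by norm_num, ?_⟩⟩
  intro k hk ν hν hpos T hT
  have hp : Even ((2 ^ k) ^ 2) := by
    rw [← pow_mul]; exact Even.pow_of_ne_zero even_two (by omega)
  have h := integral_re_charFun_le ν (fun t => (hpos t).2) hT hp (by positivity) (2 ^ 2 ^ k)
  have hI : 0 ≤ ∫ x, |Real.sinc (x * T)| ^ ((2 ^ k) ^ 2) ∂ν := by positivity
  have hc := two_pow_mul_two_pow_sq_le hε (2 ^ k)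
  rw [Nat.cast_pow 2 (2 ^ k), Nat.cast_ofNat] at h
  refine h.trans ?_
  calc _ = ((2 : ℝ) ^ 2 ^ k * 2 ^ (2 ^ k) ^ 2) *
        (T * ∫ x, |Real.sinc (x * T)| ^ ((2 ^ k) ^ 2) ∂ν) := by ring
    _ ≤ _ := mul_le_mul_of_nonneg_right hc (by positivity)
    _ = _ := by ring
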